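/- Let $\mathcal S,\mathcal A$ be measurable spaces, $H,K\ge 1$, $s_0\in\mathcal S$, and let $r:\mathcal S\times\mathcal A\to\mathbb R$ be a known measurable reward. Let $\mathcal P$ be a finite class of time-homogeneous transition models $P:\mathcal S\times\mathcal A\to\Delta(\mathcal S)$, each given by jointly measurable conditional densities $P(s'\mid s,a)$ with respect to a common reference $\nu$ (e.g. counting or Lebesgue measure; more generally an s-finite kernel $\nu(s,a)$), and let $P^\star\in\mathcal P$ be the true model (realizability). Let $\Pi$ be the set of all deterministic non-stationary policies $\pi=(\pi_0,\dots,\pi_{H-1})$, $\pi_h:\mathcal S\to\mathcal A$ measurable, let $V^\pi_{h;P}(s)$ be the expected total reward of $\pi$ under $P$ from step $h$ and state $s$ up to the horizon $H$, and write $V^\pi=V^\pi_{0;P^\star}(s_0)$. Assume $V^\pi_{h;P}(s)\in[0,1]$ for all $\pi\in\Pi$, $0\le h\le H$, $P\in\mathcal P$, $s\in\mathcal S$. The dataset $\mathcal D$ consists of $K$ random trajectories $(s^k_0,a^k_0,\dots,s^k_{H-1},a^k_{H-1},s^k_H)$, $k=1,\dots,K$, with $s^k_0=s_0$, where the actions may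 depend arbitrarily (adversarially, possibly with randomization) on the history, and where, conditionally on all earlier trajectories and on the states and actions of trajectory $k$ up to $(s^k_h,a^k_h)$, the next state satisfies $s^k_{h+1}\sim P^\star(\cdot\mid s^k_h,a^k_h)$. Let $\delta\in(0,1)$ and $\beta=4\log(|\mathcal P|/\delta)$. The pessimistic offline algorithm forms the version space $$\widehat{\mathcal P}=\Big\{P\in\mathcal P:\ \sum_{k,h}\log P(s^k_{h+1}\mid s^k_h,a^k_h)\ \ge\ \max_{Q\in\mathcal P}\sum_{k,h}\log Q(s^k_{h+1}\mid s^k_h,a^k_h)-\beta\Big\}$$ and outputs $\widehat\pi\in\arg\max_{\pi\in\Pi}\min_{P\in\widehat{\mathcal P}}V^\pi_{0;P}(s_0)$. For a comparator policy $\pi^*\in\Pi$ with state-action distributions $d^{\pi^*}_h$ under $P^\star$, define, with $\mathbb H^2(p\,\|\,q)=\tfrac12\int(\sqrt p-\sqrt q)^2\,d\nu$, $$C^{\pi^*}_{\mathcal D}=\max_{0\le h<H,\ P\in\mathcal P}\ \frac{\mathbb E_{(s,a)\sim d^{\pi^*}_h}\,\mathbb H^2\big(P(s,a)\,\|\,P^\star(s,a)\big)}{\frac1K\sum_{k=1}^K\mathbb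 H^2\big(P(s^k_h,a^k_h)\,\|\,P^\star(s^k_h,a^k_h)\big)}\in[0,\infty]\qquad(0/0=0).$$ Then there is a universal constant $c>0$ such that, whenever $P^\star$ is deterministic (every $P^\star(\cdot\mid s,a)$ is a point mass), the following hold. 1. With probability at least $1-\delta$, simultaneously for every comparator $\pi^*\in\Pi$ and every output $\widehat\pi$ of the algorithm, $$V^{\pi^*}-V^{\widehat\pi}\ \le\ c\,\frac{C^{\pi^*}_{\mathcal D}\,\log(|\mathcal P|/\delta)}{K}.$$ 2. For every $\pi^*\in\Pi$ and every constant $C^{\pi^*}\in[0,\infty)$ such that $C^{\pi^*}_{\mathcal D}\le C^{\pi^*}$ with probability at least $1-\delta$, with probability at least $1-\delta$ every output $\widehat\pi$ of the algorithm satisfies $$V^{\pi^*}-V^{\widehat\pi}\ \le\ c\,\frac{C^{\pi^*}\,\log(|\mathcal P|/\delta)}{K}.$$ -/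

import Mathlib

open MeasureTheory ProbabilityTheory
open scoped ENNReal NNReal

noncomputable section

namespace OfflineRL

/-- A time-homogeneous transition model `P : S × A → Δ(S)`, given by its conditional densities
`P(s' | s, a)` with respect to a common reference `ν`.  A fixed reference measure (counting
measure for probability mass functions, Lebesgue measure for pdfs) is a constant kernel `ν`;
letting `ν` depend on `(s, a)` also covers deterministic transitions on a continuous space. -/
structure TransitionModel {S A : Type*} [MeasurableSpace S] [MeasurableSpace A]
    (ν : Kernel (S × A) S) where
  density : S × A → S → ℝ≥0
  measurable_density : Measurable (Function.uncurry density)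
  lintegral_density : ∀ x, ∫⁻ s', (density x s' : ℝ≥0∞) ∂(ν x) = 1

/-- Deterministic non-stationary (measurable) policies; the action at step `h` in state `s` is
`π.act h s`.  With horizon `H` only the maps `act 0, …, act (H - 1)` are ever used. -/
structure Policy (S A : Type*) [MeasurableSpace S] [MeasurableSpace A] where
  act : ℕ → S → A
  measurable_act : ∀ h, Measurable (act h)

/-- A trajectory `s_0, a_0, s_1, …, s_{H-1}, a_{H-1}, s_H`. -/
structure Trajectory (S A : Type*) (H : ℕ) where
  state : Fin (H + 1) → S
  action : Fin H → A

/-- A dataset of `K` trajectories. -/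
abbrev Dataset (S A : Type*) (H K : ℕ) := Fin K → Trajectory S A H

section

variable {S A : Type*} [MeasurableSpace S] [MeasurableSpace A] {ν : Kernel (S × A) S}

/-- The next-state distribution `P(· | s, a)`. -/
def TransitionModel.law (P : TransitionModel ν) (x : S × A) : Measure S :=
  (ν x).withDensity fun s' => (P.density x s' : ℝ≥0∞)

/-- Every next-state distribution is a point mass. -/
def TransitionModel.IsDeterministic (P : TransitionModel ν) : Prop :=
  ∀ x, ∃ s', P.law x = Measure.dirac s'

/-- Expected total reward of `π` under `P` over the next `n` steps, from state `s` at step `h`. -/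
def valueToGo (r : S × A → ℝ) (P : TransitionModel ν) (π : Policy S A) : ℕ → ℕ → S → ℝ
  | 0, _, _ => 0
  | n + 1, h, s =>
      r (s, π.act h s) + ∫ s', valueToGo r P π n (h + 1) s' ∂(P.law (s, π.act h s))

/-- The value function `V^π_{h;P}(s)` for horizon `H`. -/
def value (H : ℕ) (r : S × A → ℝ) (P : TransitionModel ν) (π : Policy S A) (h : ℕ) (s : S) : ℝ :=
  valueToGo r P π (H - h) h s

/-- The distribution of the state at step `h` when `π` is run under `P` from `s₀`. -/
def stateDist (P : TransitionModel ν) (π : Policy S A) (s₀ : S) : ℕ → Measure S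
  | 0 => Measure.dirac s₀
  | h + 1 => (stateDist P π s₀ h).bind fun s => P.law (s, π.act h s)

/-- The state-action distribution `d^π_h` under `P`. -/
def occupancy (P : TransitionModel ν) (π : Policy S A) (s₀ : S) (h : ℕ) : Measure (S × A) :=
  (stateDist P π s₀ h).map fun s => (s, π.act h s)

/-- The squared Hellinger distance between `P(s, a)` and `Q(s, a)`. -/
def sqHellinger (P Q : TransitionModel ν) (x : S × A) : ℝ≥0∞ :=
  (1 / 2) * ∫⁻ s', ENNReal.ofReal
    ((Real.sqrt (P.density x s') - Real.sqrt (Q.density x s')) ^ 2) ∂(ν x)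

variable {H K : ℕ}

/-- The state-action pair at step `h` of a trajectory. -/
def Trajectory.pair (τ : Trajectory S A H) (h : Fin H) : S × A :=
  (τ.state h.castSucc, τ.action h)

/-- The log-likelihood of `P` on the `K * H` transition tuples of the dataset, with
`log 0 = -∞`. -/
def logLikelihood (P : TransitionModel ν) (D : Dataset S A H K) : EReal :=
  ∑ k, ∑ h, ENNReal.log (P.density ((D k).pair h) ((D k).state h.succ) : ℝ≥0∞)

/-- The version space: all models whose log-likelihood is within `β` of the maximum. -/
def versionSpace (Pcal : Finset (TransitionModel ν)) (β : ℝ) (D : Dataset S A H K) :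
    Set (TransitionModel ν) :=
  {P | P ∈ Pcal ∧ (Pcal.sup fun Q => logLikelihood Q D) - (β : EReal) ≤ logLikelihood P D}

/-- `min_{P ∈ version space} V^π_{0;P}(s₀)`.  For nonempty `Pcal` and `β ≥ 0` the version space is
finite and nonempty, so this infimum is a minimum. -/
def pessimisticValue (Pcal : Finset (TransitionModel ν)) (β : ℝ) (r : S × A → ℝ) (s₀ : S)
    (D : Dataset S A H K) (π : Policy S A) : ℝ :=
  sInf ((fun P => value H r P π 0 s₀) '' versionSpace Pcal β D)

/-- `πhat` is a possible output of the pessimistic algorithm on the dataset `D`, i.e.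
`πhat ∈ argmax_π min_{P ∈ version space} V^π_{0;P}(s₀)`. -/
def IsPessimisticOutput (Pcal : Finset (TransitionModel ν)) (β : ℝ) (r : S × A → ℝ) (s₀ : S)
    (D : Dataset S A H K) (πhat : Policy S A) : Prop :=
  ∀ π : Policy S A, pessimisticValue Pcal β r s₀ D π ≤ pessimisticValue Pcal β r s₀ D πhat

/-- The data-dependent single-policy concentrability coefficient
`max_{h, P} E_{d^π_h} H²(P ‖ P⋆) / ((1/K) ∑_k H²(P ‖ P⋆)(s_h^k, a_h^k))`,
valued in `[0, ∞]` with `0 / 0 = 0` and `x / 0 = ∞` for `x > 0`. -/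
def concentrability (Pcal : Finset (TransitionModel ν)) (Pstar : TransitionModel ν) (s₀ : S)
    (D : Dataset S A H K) (π : Policy S A) : ℝ≥0∞ :=
  ⨆ h : Fin H, ⨆ P ∈ Pcal,
    (∫⁻ x, sqHellinger P Pstar x ∂(occupancy Pstar π s₀ h)) /
      ((∑ k, sqHellinger P Pstar ((D k).pair h)) / (K : ℝ≥0∞))

variable {Ω : Type*} [MeasurableSpace Ω]

/-- The σ-algebra of the history up to and including `(s_h^k, a_h^k)`: all earlier trajectories,
and the states and actions of trajectory `k` up to step `h`. -/
@[reducible] def history (D : Ω → Dataset S A H K) (k : Fin K) (h : Fin H) : MeasurableSpace Ω :=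
  (⨆ (j : Fin K) (i : Fin (H + 1)) (_ : j < k ∨ (j = k ∧ i ≤ h.castSucc)),
    MeasurableSpace.comap (fun ω => (D ω j).state i) inferInstance) ⊔
  (⨆ (j : Fin K) (i : Fin H) (_ : j < k ∨ (j = k ∧ i ≤ h)),
    MeasurableSpace.comap (fun ω => (D ω j).action i) inferInstance)

/-- `D` is a random offline dataset, generated adversarially: every trajectory starts at `s₀`,
the actions may depend in any (also randomized) way on the history, and given the history the
next state has law `P⋆(s_h^k, a_h^k)`. -/
structure IsOfflineDataset (μ : Measure Ω) (Pstar : TransitionModel ν) (s₀ : S)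
    (D : Ω → Dataset S A H K) : Prop where
  measurable_state : ∀ k i, Measurable fun ω => (D ω k).state i
  measurable_action : ∀ k h, Measurable fun ω => (D ω k).action h
  init : ∀ k, ∀ᵐ ω ∂μ, (D ω k).state 0 = s₀
  transition : ∀ (k : Fin K) (h : Fin H) (B : Set S), MeasurableSet B →
    μ[((fun ω => (D ω k).state h.succ) ⁻¹' B).indicator (fun _ => (1 : ℝ)) | history D k h]
      =ᵐ[μ] fun ω => (Pstar.law ((D ω k).pair h)).real B

end

end OfflineRL

end

namespace OfflineRL

/-! ### Hellinger distance to a point mass -/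

section Model

variable {S A : Type*} [MeasurableSpace S] [MeasurableSpace A] {ν : Kernel (S × A) S}

/-! If `Q(· | x)` is the point mass at `t`, the Hellinger affinity of `P` and `Q` at `x` is
`√(P(t|x) / Q(t|x))`, so the likelihood ratio at the only possible successor equals `(1 - H²)²`,
which is at most `exp(-2 H²)`. Summed over the data, the log-likelihood of `P` almost surely falls
below that of the truth by at least twice its empirical squared Hellinger distance. Hence, without
any concentration inequality or union bound, the truth lies in the version space and every surviving
`P` has empirical distance at most `β / 2` (`IsTypicalDataset.mem_versionSpace`,
`IsTypicalDataset.empiricalHellinger_le`).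

For planning, `P` gives the true successor mass `(1 - H²)² ≥ 1 - 2 H²`. Values lie in `[0, 1]`, so
each step along the single path of the comparator loses at most `2 H²`, with no extra factor of the
horizon (`value_sub_le`). Concentrability transfers path distances to data distances, and pessimism
reduces the suboptimality to this loss, giving `C β / K`. -/

lemma TransitionModel.measurable_density_apply (P : TransitionModel ν) (x : S × A) :
    Measurable (P.density x) :=
  P.measurable_density.comp measurable_prodMk_left

instance TransitionModel.isProbabilityMeasure_law (P : TransitionModel ν) (x : S × A) :
    IsProbabilityMeasure (P.law x) :=
  ⟨by rw [TransitionModel.law, withDensity_apply _ MeasurableSet.univ, Measure.restrict_univ,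
    P.lintegral_density]⟩

/-- A transition model as a Markov kernel. -/
noncomputable def TransitionModel.kernel [IsSFiniteKernel ν] (P : TransitionModel ν) :
    Kernel (S × A) S :=
  ν.withDensity fun x s' => (P.density x s' : ℝ≥0∞)

lemma TransitionModel.kernel_apply [IsSFiniteKernel ν] (P : TransitionModel ν) (x : S × A) :
    P.kernel x = P.law x :=
  Kernel.withDensity_apply _ P.measurable_density.coe_nnreal_ennreal x

instance TransitionModel.isMarkovKernel_kernel [IsSFiniteKernel ν] (P : TransitionModel ν) :
    IsMarkovKernel P.kernel :=
  ⟨fun x => by rw [P.kernel_apply]; infer_instance⟩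

lemma measurable_sqHellinger [IsSFiniteKernel ν] (P Q : TransitionModel ν) :
    Measurable (sqHellinger P Q) := by
  have hP := P.measurable_density
  have hQ := Q.measurable_density
  refine Measurable.const_mul (Measurable.lintegral_kernel_prod_right ?_) _
  exact (((hP.coe_nnreal_real.sqrt).sub (hQ.coe_nnreal_real.sqrt)).pow_const 2).ennreal_ofReal

/-- The singleton `{t}` need not be measurable, so the point mass is tested on the zero set of the
density, which is measurable and null for the law. -/
lemma density_pos_of_law_eq_dirac {Q : TransitionModel ν} {x : S × A} {t : S}
    (h : Q.law x = Measure.dirac t) : 0 < Q.density x t := by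
  have hq := Q.measurable_density_apply x
  have hs : MeasurableSet {s | Q.density x s = 0} := hq (measurableSet_singleton 0)
  have h0 : Q.law x {s | Q.density x s = 0} = 0 := by
    rw [TransitionModel.law, withDensity_apply _ hs, setLIntegral_congr_fun (g := 0) hs]
    · simp
    · intro s hs
      simpa using hs
  rw [h, Measure.dirac_apply' _ hs] at h0
  by_contra hc
  simp_all

/-- For a point mass `Q(· | x) = δ_t`, the Hellinger affinity of `P` and `Q` is
`√(P(t | x) / Q(t | x))`. -/
lemma sqHellinger_add_sqrt_eq_one {P Q : TransitionModel ν} {x : S × A} {t : S}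
    (h : Q.law x = Measure.dirac t) :
    sqHellinger P Q x + ENNReal.ofReal (Real.sqrt (P.density x t / Q.density x t)) = 1 := by
  have hp := (P.measurable_density_apply x).coe_nnreal_real
  have hq := (Q.measurable_density_apply x).coe_nnreal_real
  -- Since `√(pq) = √(p/q) · q`, the affinity is an integral against the point mass. Where `q = 0`
  -- both sides vanish.
  have haff : ∫⁻ s, ENNReal.ofReal (Real.sqrt (P.density x s) * Real.sqrt (Q.density x s)) ∂(ν x)
      = ENNReal.ofReal (Real.sqrt (P.density x t / Q.density x t)) := by
    have hm : Measurable fun s => ENNReal.ofReal (Real.sqrt (P.density x s / Q.density x s)) :=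
      ((hp.div hq).sqrt).ennreal_ofReal
    rw [← lintegral_dirac' t hm, ← h, TransitionModel.law,
      lintegral_withDensity_eq_lintegral_mul _
        (Q.measurable_density_apply x).coe_nnreal_ennreal hm]
    refine lintegral_congr fun s => ?_
    rw [Pi.mul_apply, ← ENNReal.ofReal_coe_nnreal, ← ENNReal.ofReal_mul (NNReal.coe_nonneg _)]
    congr 1
    rcases eq_or_lt_of_le (NNReal.coe_nonneg (Q.density x s)) with h0 | h0
    · simp [← h0]
    · rw [Real.sqrt_div (NNReal.coe_nonneg _)]
      have hs := Real.sq_sqrt h0.le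
      have hs' := Real.sqrt_pos.2 h0
      field_simp
      rw [hs]
  -- The expanded square, kept in additive form to avoid truncated subtraction in `ℝ≥0∞`.
  have hsum : ∫⁻ s, ENNReal.ofReal ((Real.sqrt (P.density x s) - Real.sqrt (Q.density x s)) ^ 2)
        ∂(ν x)
      + 2 * ∫⁻ s, ENNReal.ofReal (Real.sqrt (P.density x s) * Real.sqrt (Q.density x s)) ∂(ν x)
      = 2 := by
    have hm : Measurable fun s =>
        ENNReal.ofReal (Real.sqrt (P.density x s) * Real.sqrt (Q.density x s)) :=
      (hp.sqrt.mul hq.sqrt).ennreal_ofReal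
    have hm' : Measurable fun s =>
        ENNReal.ofReal ((Real.sqrt (P.density x s) - Real.sqrt (Q.density x s)) ^ 2) :=
      ((hp.sqrt.sub hq.sqrt).pow_const 2).ennreal_ofReal
    rw [← lintegral_const_mul _ hm, ← lintegral_add_left hm']
    calc _ = ∫⁻ s, ((P.density x s : ℝ≥0∞) + (Q.density x s : ℝ≥0∞)) ∂(ν x) := by
            refine lintegral_congr fun s => ?_
            have h2 : (2 : ℝ≥0∞) = ENNReal.ofReal 2 := by simp
            rw [h2, ← ENNReal.ofReal_mul zero_le_two, ← ENNReal.ofReal_add (sq_nonneg _)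
              (by positivity), ← ENNReal.ofReal_coe_nnreal, ← ENNReal.ofReal_coe_nnreal,
              ← ENNReal.ofReal_add (NNReal.coe_nonneg _) (NNReal.coe_nonneg _)]
            congr 1
            have h1 := Real.sq_sqrt (NNReal.coe_nonneg (P.density x s))
            have h2 := Real.sq_sqrt (NNReal.coe_nonneg (Q.density x s))
            linear_combination h1 + h2
      _ = 2 := by
            rw [lintegral_add_left (P.measurable_density_apply x).coe_nnreal_ennreal,
              P.lintegral_density, Q.lintegral_density, one_add_one_eq_two]
  rw [haff] at hsum
  have h2 : (1 / 2 : ℝ≥0∞) * 2 = 1 := by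
    rw [one_div]; exact ENNReal.inv_mul_cancel two_ne_zero ENNReal.ofNat_ne_top
  calc _ = (1 / 2) * (∫⁻ s, ENNReal.ofReal
            ((Real.sqrt (P.density x s) - Real.sqrt (Q.density x s)) ^ 2) ∂(ν x)
          + 2 * ENNReal.ofReal (Real.sqrt (P.density x t / Q.density x t))) := by
        rw [mul_add, ← mul_assoc, h2, one_mul, sqHellinger]
    _ = 1 := by rw [hsum, h2]

lemma TransitionModel.IsDeterministic.sqHellinger_le_one {Q : TransitionModel ν}
    (hQ : Q.IsDeterministic) (P : TransitionModel ν) (x : S × A) : sqHellinger P Q x ≤ 1 := by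
  obtain ⟨t, ht⟩ := hQ x
  exact (sqHellinger_add_sqrt_eq_one (P := P) ht).symm ▸ le_self_add

lemma TransitionModel.IsDeterministic.sqHellinger_ne_top {Q : TransitionModel ν}
    (hQ : Q.IsDeterministic) (P : TransitionModel ν) (x : S × A) : sqHellinger P Q x ≠ ∞ :=
  ne_top_of_le_ne_top ENNReal.one_ne_top (hQ.sqHellinger_le_one P x)

/-- `s'` is a successor of `x` at which the likelihood ratio of `P` to `Q` is the square of their
Hellinger affinity. -/
def IsTypicalTransition (P Q : TransitionModel ν) (x : S × A) (s' : S) : Prop :=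
  0 < Q.density x s' ∧
    (P.density x s' : ℝ) = (1 - (sqHellinger P Q x).toReal) ^ 2 * Q.density x s'

/-- Typicality is a measurable substitute for the event that the successor is `t`; it retains all
the likelihood argument needs. -/
lemma isTypicalTransition_of_law_eq_dirac (P : TransitionModel ν) {Q : TransitionModel ν}
    {x : S × A} {t : S} (h : Q.law x = Measure.dirac t) : IsTypicalTransition P Q x t := by
  have hpos := density_pos_of_law_eq_dirac h
  refine ⟨hpos, ?_⟩
  have h1 := sqHellinger_add_sqrt_eq_one (P := P) h
  have hfin : sqHellinger P Q x ≠ ∞ := fun h => by simp [h] at h1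
  have h2 := congrArg ENNReal.toReal h1
  rw [ENNReal.toReal_add hfin ENNReal.ofReal_ne_top, ENNReal.toReal_ofReal (Real.sqrt_nonneg _),
    ENNReal.toReal_one] at h2
  have hpos' : (0 : ℝ) < Q.density x t := hpos
  rw [← h2, add_sub_cancel_left, Real.sq_sqrt (by positivity)]
  field_simp

lemma measurableSet_isTypicalTransition [IsSFiniteKernel ν] (P Q : TransitionModel ν) :
    MeasurableSet {p : (S × A) × S | IsTypicalTransition P Q p.1 p.2} := by
  have hP := P.measurable_density
  have hQ := Q.measurable_density
  refine (measurableSet_lt measurable_const hQ).inter (measurableSet_eq_fun hP.coe_nnreal_real ?_)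
  exact ((measurable_const.sub
    ((measurable_sqHellinger P Q).ennreal_toReal.comp measurable_fst)).pow_const 2).mul
      hQ.coe_nnreal_real

lemma measurableSet_isTypicalTransition_right (P Q : TransitionModel ν) (x : S × A) :
    MeasurableSet {s | IsTypicalTransition P Q x s} :=
  (measurableSet_lt measurable_const (Q.measurable_density_apply x)).inter
    (measurableSet_eq_fun (P.measurable_density_apply x).coe_nnreal_real
      ((Q.measurable_density_apply x).coe_nnreal_real.const_mul _))

lemma TransitionModel.IsDeterministic.ae_isTypicalTransition {Q : TransitionModel ν}
    (hQ : Q.IsDeterministic) (P : TransitionModel ν) (x : S × A) :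
    ∀ᵐ s ∂(Q.law x), IsTypicalTransition P Q x s := by
  obtain ⟨t, ht⟩ := hQ x
  rw [ht, ae_dirac_iff (measurableSet_isTypicalTransition_right P Q x)]
  exact isTypicalTransition_of_law_eq_dirac P ht

/-- Integrals of `[0, 1]`-valued functions drop by at most `2 H²` from a point mass to `P`. -/
lemma sub_integral_le_two_mul_sqHellinger (P : TransitionModel ν) {Q : TransitionModel ν}
    {x : S × A} {t : S} (h : Q.law x = Measure.dirac t) {f : S → ℝ} (hf : Measurable f)
    (hf01 : ∀ s, f s ∈ Set.Icc (0 : ℝ) 1) :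
    f t - ∫ s, f s ∂(P.law x) ≤ 2 * (sqHellinger P Q x).toReal := by
  set η := (sqHellinger P Q x).toReal with hη
  -- `B` stands in for `{t}`: it is measurable, contains `t`, `f` is constant on it, and there the
  -- density of `P` is `(1 - η)²` times that of `Q`.
  set B : Set S := {s | IsTypicalTransition P Q x s} ∩ f ⁻¹' {f t} with hB
  have hBm : MeasurableSet B :=
    (measurableSet_isTypicalTransition_right P Q x).inter (hf (measurableSet_singleton _))
  have htB : t ∈ B := ⟨isTypicalTransition_of_law_eq_dirac P h, rfl⟩
  have hPB : P.law x B = ENNReal.ofReal ((1 - η) ^ 2) := by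
    calc P.law x B = ∫⁻ s in B, (P.density x s : ℝ≥0∞) ∂(ν x) := withDensity_apply _ hBm
      _ = ∫⁻ s in B, ENNReal.ofReal ((1 - η) ^ 2) * (Q.density x s : ℝ≥0∞) ∂(ν x) := by
          refine setLIntegral_congr_fun hBm fun s hs => ?_
          rw [← ENNReal.ofReal_coe_nnreal, hs.1.2, ENNReal.ofReal_mul (sq_nonneg _),
            ENNReal.ofReal_coe_nnreal]
      _ = ENNReal.ofReal ((1 - η) ^ 2) * Q.law x B := by
          rw [lintegral_const_mul _ (Q.measurable_density_apply x).coe_nnreal_ennreal,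
            TransitionModel.law, withDensity_apply _ hBm]
      _ = _ := by rw [h, Measure.dirac_apply' _ hBm, Set.indicator_of_mem htB]; simp
  have hint : Integrable f (P.law x) :=
    Integrable.of_mem_Icc 0 1 hf.aemeasurable (ae_of_all _ hf01)
  have hle : f t * (1 - η) ^ 2 ≤ ∫ s, f s ∂(P.law x) := by
    calc f t * (1 - η) ^ 2 = ∫ _ in B, f t ∂(P.law x) := by
          rw [setIntegral_const, measureReal_def, hPB, ENNReal.toReal_ofReal (sq_nonneg _),
            smul_eq_mul, mul_comm]
      _ = ∫ s in B, f s ∂(P.law x) := setIntegral_congr_fun hBm fun s hs => hs.2.symm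
      _ ≤ ∫ s, f s ∂(P.law x) :=
          setIntegral_le_integral hint (ae_of_all _ fun s => (hf01 s).1)
  have hη0 : 0 ≤ η := ENNReal.toReal_nonneg
  -- The loss is at most `f t · (2η - η²)`, and `0 ≤ f t ≤ 1`.
  nlinarith [(hf01 t).1, (hf01 t).2, sq_nonneg η, mul_nonneg (hf01 t).1 (sq_nonneg η),
    mul_nonneg (sub_nonneg.2 (hf01 t).2) hη0]

end Model

/-! ### Value loss along the path of a policy -/

section Planning

variable {S A : Type*} [MeasurableSpace S] [MeasurableSpace A] {ν : Kernel (S × A) S}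

lemma Policy.measurable_pair (π : Policy S A) (h : ℕ) : Measurable fun s => (s, π.act h s) :=
  measurable_id.prodMk (π.measurable_act h)

lemma measurable_valueToGo [IsSFiniteKernel ν] {r : S × A → ℝ} (hr : Measurable r)
    (P : TransitionModel ν) (π : Policy S A) (n : ℕ) :
    ∀ h, Measurable (valueToGo r P π n h) := by
  induction n with
  | zero => exact fun _ => measurable_const
  | succ n ih =>
    intro h
    refine (hr.comp (π.measurable_pair h)).add ?_
    have := ((ih (h + 1)).stronglyMeasurable.integral_kernel (κ := P.kernel)).measurable.comp
      (π.measurable_pair h)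
    simpa only [Function.comp_def, P.kernel_apply] using this

namespace TransitionModel.IsDeterministic

variable {Q : TransitionModel ν}

/-- The next state under a deterministic model. -/
noncomputable def next (hQ : Q.IsDeterministic) (x : S × A) : S := (hQ x).choose

lemma law_eq (hQ : Q.IsDeterministic) (x : S × A) : Q.law x = Measure.dirac (hQ.next x) :=
  (hQ x).choose_spec

/-- The states visited by a policy under a deterministic model. -/
noncomputable def path (hQ : Q.IsDeterministic) (π : Policy S A) (s₀ : S) : ℕ → S
  | 0 => s₀
  | h + 1 => hQ.next (path hQ π s₀ h, π.act h (path hQ π s₀ h))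

/-- The state-action pairs visited by a policy under a deterministic model. -/
noncomputable def pathPair (hQ : Q.IsDeterministic) (π : Policy S A) (s₀ : S) (h : ℕ) : S × A :=
  (hQ.path π s₀ h, π.act h (hQ.path π s₀ h))

/-- Only one path is followed, so the chosen successor map `next` need not be measurable. -/
lemma stateDist_eq [IsSFiniteKernel ν] (hQ : Q.IsDeterministic) (π : Policy S A) (s₀ : S) (h : ℕ) :
    stateDist Q π s₀ h = Measure.dirac (hQ.path π s₀ h) := by
  induction h with
  | zero => rfl
  | succ h ih =>
    have hm : Measurable fun s => Q.law (s, π.act h s) := by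
      simpa only [Function.comp_def, Q.kernel_apply] using
        Q.kernel.measurable.comp (π.measurable_pair h)
    rw [stateDist, ih, Measure.dirac_bind hm, hQ.law_eq, path]

lemma occupancy_eq [IsSFiniteKernel ν] (hQ : Q.IsDeterministic) (π : Policy S A) (s₀ : S)
    (h : ℕ) : occupancy Q π s₀ h = Measure.dirac (hQ.pathPair π s₀ h) := by
  rw [occupancy, hQ.stateDist_eq, Measure.map_dirac' (π.measurable_pair h), pathPair]

/-- The rewards cancel at each step. What remains is the gap at the next path state plus the error
of integrating the value of `P` against `P` rather than the point mass. -/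
lemma valueToGo_sub_le [IsSFiniteKernel ν] (hQ : Q.IsDeterministic) {r : S × A → ℝ}
    (hr : Measurable r) (P : TransitionModel ν) (π : Policy S A) (s₀ : S) {H : ℕ}
    (hP : ∀ n h s, n + h = H → valueToGo r P π n h s ∈ Set.Icc (0 : ℝ) 1) (n : ℕ) :
    ∀ h, n + h = H →
      valueToGo r Q π n h (hQ.path π s₀ h) - valueToGo r P π n h (hQ.path π s₀ h) ≤
        2 * ∑ i ∈ Finset.range n, (sqHellinger P Q (hQ.pathPair π s₀ (h + i))).toReal := by
  induction n with
  | zero => intro h _; simp [valueToGo]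
  | succ n ih =>
    intro h hh
    have h1 := ih (h + 1) (by omega)
    have h2 := sub_integral_le_two_mul_sqHellinger P (hQ.law_eq (hQ.pathPair π s₀ h))
      (measurable_valueToGo hr P π n (h + 1)) (fun s => hP n (h + 1) s (by omega))
    have h3 : ∫ s', valueToGo r Q π n (h + 1) s' ∂(Q.law (hQ.pathPair π s₀ h))
        = valueToGo r Q π n (h + 1) (hQ.path π s₀ (h + 1)) := by
      rw [hQ.law_eq, integral_dirac' _ _ (measurable_valueToGo hr Q π n (h + 1)).stronglyMeasurable]
      rfl
    have h4 : hQ.next (hQ.pathPair π s₀ h) = hQ.path π s₀ (h + 1) := rfl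
    rw [h4] at h2
    rw [Finset.sum_range_succ', add_zero]
    simp only [valueToGo]
    change r (hQ.pathPair π s₀ h) + ∫ s', valueToGo r Q π n (h + 1) s' ∂(Q.law (hQ.pathPair π s₀ h))
      - (r (hQ.pathPair π s₀ h) +
        ∫ s', valueToGo r P π n (h + 1) s' ∂(P.law (hQ.pathPair π s₀ h))) ≤ _
    have h5 : ∀ i, h + 1 + i = h + (i + 1) := fun i => by omega
    simp only [h5] at h1
    rw [h3]
    linarith

/-- Under a deterministic model `Q`, the value of `π` exceeds its value under `P` by at most twice
the sum of the squared Hellinger distances along the path of `π`. -/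
lemma value_sub_le [IsSFiniteKernel ν] (hQ : Q.IsDeterministic) {r : S × A → ℝ}
    (hr : Measurable r) (P : TransitionModel ν) (π : Policy S A) (s₀ : S) {H : ℕ}
    (hP : ∀ h s, h ≤ H → value H r P π h s ∈ Set.Icc (0 : ℝ) 1) :
    value H r Q π 0 s₀ - value H r P π 0 s₀ ≤
      2 * ∑ h : Fin H, (sqHellinger P Q (hQ.pathPair π s₀ h)).toReal := by
  have h := hQ.valueToGo_sub_le hr P π s₀ (H := H)
    (fun n h s hn => by
      have := hP h s (by omega)
      rwa [value, show H - h = n by omega] at this) H 0 (by omega)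
  simp only [zero_add] at h
  rw [← Finset.sum_range fun i => (sqHellinger P Q (hQ.pathPair π s₀ i)).toReal]
  exact h

/-- The squared Hellinger distance on the path of a policy is controlled by the one on the data. -/
lemma sqHellinger_pathPair_le [IsSFiniteKernel ν] (hQ : Q.IsDeterministic) {H K : ℕ}
    {Pcal : Finset (TransitionModel ν)} {P : TransitionModel ν} (hP : P ∈ Pcal) (s₀ : S)
    (D : Dataset S A H K) (π : Policy S A) (hC : concentrability Pcal Q s₀ D π ≠ ∞) (hK : 0 < K)
    (h : Fin H) :
    sqHellinger P Q (hQ.pathPair π s₀ h) ≤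
      concentrability Pcal Q s₀ D π * ((∑ k, sqHellinger P Q ((D k).pair h)) / (K : ℝ≥0∞)) := by
  have hle : (∫⁻ x, sqHellinger P Q x ∂(occupancy Q π s₀ h)) /
      ((∑ k, sqHellinger P Q ((D k).pair h)) / (K : ℝ≥0∞)) ≤ concentrability Pcal Q s₀ D π :=
    (le_iSup₂_of_le (f := fun P (_ : P ∈ Pcal) => (∫⁻ x, sqHellinger P Q x ∂(occupancy Q π s₀ h)) /
      ((∑ k, sqHellinger P Q ((D k).pair h)) / (K : ℝ≥0∞))) P hP le_rfl).trans
      (le_iSup (fun h : Fin H => ⨆ P ∈ Pcal, (∫⁻ x, sqHellinger P Q x ∂(occupancy Q π s₀ h)) /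
        ((∑ k, sqHellinger P Q ((D k).pair h)) / (K : ℝ≥0∞))) h)
  have hfin : (∑ k, sqHellinger P Q ((D k).pair h)) / (K : ℝ≥0∞) ≠ ∞ :=
    ENNReal.div_ne_top (ENNReal.sum_ne_top.2 fun k _ => hQ.sqHellinger_ne_top P _)
      (by exact_mod_cast hK.ne')
  -- Since `C ≠ ∞`, a zero denominator forces a zero numerator, so clearing it is legitimate.
  rw [ENNReal.div_le_iff_le_mul (Or.inr hC) (Or.inl hfin), hQ.occupancy_eq,
    lintegral_dirac' _ (measurable_sqHellinger P Q)] at hle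
  exact hle

end TransitionModel.IsDeterministic

end Planning

/-! ### Likelihoods, version space and pessimism -/

section Data

variable {S A : Type*} [MeasurableSpace S] [MeasurableSpace A] {ν : Kernel (S × A) S}
  {H K : ℕ} {Ω : Type*} [mΩ : MeasurableSpace Ω] {μ : Measure Ω} {Q : TransitionModel ν} {s₀ : S}
  {D : Ω → Dataset S A H K}

namespace IsOfflineDataset

lemma history_le (hD : IsOfflineDataset μ Q s₀ D) (k : Fin K) (h : Fin H) :
    history D k h ≤ mΩ :=
  sup_le (iSup_le fun j => iSup_le fun i => iSup_le fun _ => (hD.measurable_state j i).comap_le)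
    (iSup_le fun j => iSup_le fun i => iSup_le fun _ => (hD.measurable_action j i).comap_le)

lemma measurable_pair_history {Ω : Type*} (D : Ω → Dataset S A H K) (k : Fin K) (h : Fin H) :
    Measurable[history D k h] fun ω => (D ω k).pair h := by
  refine Measurable.prodMk ?_ ?_
  · refine Measurable.of_comap_le (le_sup_of_le_left ?_)
    exact le_iSup_of_le k (le_iSup_of_le h.castSucc (le_iSup_of_le (Or.inr ⟨rfl, le_rfl⟩) le_rfl))
  · refine Measurable.of_comap_le (le_sup_of_le_right ?_)
    exact le_iSup_of_le k (le_iSup_of_le h (le_iSup_of_le (Or.inr ⟨rfl, le_rfl⟩) le_rfl))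

lemma measurable_pair (hD : IsOfflineDataset μ Q s₀ D) (k : Fin K) (h : Fin H) :
    Measurable fun ω => (D ω k).pair h :=
  (measurable_pair_history D k h).mono (hD.history_le k h) le_rfl

/-- The joint law of a state-action pair of the dataset and the state that follows it. -/
lemma map_pair_next [IsProbabilityMeasure μ] [IsSFiniteKernel ν] (hD : IsOfflineDataset μ Q s₀ D)
    (k : Fin K) (h : Fin H) :
    μ.map (fun ω => ((D ω k).pair h, (D ω k).state h.succ)) =
      (μ.map fun ω => (D ω k).pair h) ⊗ₘ Q.kernel := by
  have hpm := hD.measurable_pair k h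
  have hsm := hD.measurable_state k h.succ
  have := Measure.isProbabilityMeasure_map (μ := μ) (hpm.prodMk hsm).aemeasurable
  refine Measure.ext_prod fun {G} {B} hG hB => ?_
  have hG' : MeasurableSet[history D k h] ((fun ω => (D ω k).pair h) ⁻¹' G) :=
    measurable_pair_history D k h hG
  have hB' : MeasurableSet ((fun ω => (D ω k).state h.succ) ⁻¹' B) := hsm hB
  have hlaw : Measurable fun ω => Q.law ((D ω k).pair h) B := by
    have := (Q.kernel.measurable_coe hB).comp hpm
    simpa only [Function.comp_def, Q.kernel_apply] using this
  -- The event that the pair lies in `G` belongs to the history, so the conditional law may be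
  -- integrated over it.
  have key := setIntegral_condExp (μ := μ) (hD.history_le k h)
    (f := ((fun ω => (D ω k).state h.succ) ⁻¹' B).indicator fun _ => (1 : ℝ))
    ((integrable_const 1).indicator hB') hG'
  rw [setIntegral_congr_ae (hpm hG) ((hD.transition k h B hB).mono fun _ h _ => h),
    setIntegral_indicator hB', setIntegral_const, smul_eq_mul, mul_one] at key
  simp only [measureReal_def] at key
  rw [integral_toReal hlaw.aemeasurable
    (ae_of_all _ fun ω => prob_le_one.trans_lt ENNReal.one_lt_top)] at key
  have hfin : ∫⁻ ω in (fun ω => (D ω k).pair h) ⁻¹' G, Q.law ((D ω k).pair h) B ∂μ ≠ ∞ := by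
    refine ne_top_of_le_ne_top (measure_ne_top μ ((fun ω => (D ω k).pair h) ⁻¹' G)) ?_
    calc _ ≤ ∫⁻ ω in (fun ω => (D ω k).pair h) ⁻¹' G, 1 ∂μ := lintegral_mono fun _ => prob_le_one
      _ = _ := by simp
  rw [ENNReal.toReal_eq_toReal_iff' hfin (measure_ne_top _ _)] at key
  rw [Measure.map_apply (hpm.prodMk hsm) (hG.prod hB), Measure.compProd_apply_prod hG hB,
    setLIntegral_map hG (Q.kernel.measurable_coe hB) hpm]
  simp only [Q.kernel_apply]
  rw [key]
  rfl

lemma ae_isTypicalTransition [IsProbabilityMeasure μ] [IsSFiniteKernel ν]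
    (hD : IsOfflineDataset μ Q s₀ D) (hQ : Q.IsDeterministic) (P : TransitionModel ν)
    (k : Fin K) (h : Fin H) :
    ∀ᵐ ω ∂μ, IsTypicalTransition P Q ((D ω k).pair h) ((D ω k).state h.succ) := by
  have hm := measurableSet_isTypicalTransition P Q
  refine ae_of_ae_map (p := fun x => IsTypicalTransition P Q x.1 x.2)
    ((hD.measurable_pair k h).prodMk (hD.measurable_state k h.succ)).aemeasurable ?_
  rw [hD.map_pair_next]
  refine Measure.ae_compProd_of_ae_ae hm (ae_of_all _ fun x => ?_)
  rw [Q.kernel_apply]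
  exact hQ.ae_isTypicalTransition P x

end IsOfflineDataset

/-- Every transition of the dataset is typical for `P` and `Q`, for every model `P` of the class. -/
def IsTypicalDataset (Pcal : Finset (TransitionModel ν)) (Q : TransitionModel ν)
    (D : Dataset S A H K) : Prop :=
  ∀ P ∈ Pcal, ∀ k h, IsTypicalTransition P Q ((D k).pair h) ((D k).state h.succ)

lemma IsOfflineDataset.ae_isTypicalDataset [IsProbabilityMeasure μ] [IsSFiniteKernel ν]
    (hD : IsOfflineDataset μ Q s₀ D) (hQ : Q.IsDeterministic) (Pcal : Finset (TransitionModel ν)) :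
    ∀ᵐ ω ∂μ, IsTypicalDataset Pcal Q (D ω) :=
  (Filter.eventually_all_finset Pcal).2 fun P _ => ae_all_iff.2 fun k => ae_all_iff.2 fun h =>
    hD.ae_isTypicalTransition hQ P k h

lemma ereal_coe_sum {ι : Type*} (s : Finset ι) (f : ι → ℝ) :
    ((∑ i ∈ s, f i : ℝ) : EReal) = ∑ i ∈ s, (f i : EReal) :=
  map_sum (⟨⟨Real.toEReal, EReal.coe_zero⟩, EReal.coe_add⟩ : ℝ →+ EReal) f s

variable {Pcal : Finset (TransitionModel ν)} {P : TransitionModel ν} {d : Dataset S A H K}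

/-- The total squared Hellinger distance of `P` to `Q` on the dataset. -/
noncomputable def empiricalHellinger (P Q : TransitionModel ν) (d : Dataset S A H K) : ℝ :=
  ∑ k, ∑ h, (sqHellinger P Q ((d k).pair h)).toReal

lemma empiricalHellinger_nonneg (P Q : TransitionModel ν) (d : Dataset S A H K) :
    0 ≤ empiricalHellinger P Q d :=
  Finset.sum_nonneg fun _ _ => Finset.sum_nonneg fun _ _ => ENNReal.toReal_nonneg

lemma IsTypicalDataset.logLikelihood_eq (hd : IsTypicalDataset Pcal Q d) (hQ : Q ∈ Pcal) :
    logLikelihood Q d =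
      ((∑ k, ∑ h, Real.log (Q.density ((d k).pair h) ((d k).state h.succ)) : ℝ) : EReal) := by
  simp only [logLikelihood, ereal_coe_sum]
  refine Finset.sum_congr rfl fun k _ => Finset.sum_congr rfl fun h _ => ?_
  exact ENNReal.log_of_nnreal (hd Q hQ k h).1.ne'

/-- This is `1 - η ≤ exp(-η)`, squared. Working in `EReal` includes models of zero likelihood. -/
lemma IsTypicalTransition.log_density_le (hQ : Q.IsDeterministic) {x : S × A} {s : S}
    (h : IsTypicalTransition P Q x s) :
    ENNReal.log (P.density x s : ℝ≥0∞) ≤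
      ((Real.log (Q.density x s) - 2 * (sqHellinger P Q x).toReal : ℝ) : EReal) := by
  set η := (sqHellinger P Q x).toReal with hη
  have hη1 : η ≤ 1 := by
    rw [hη, ← ENNReal.toReal_one]
    exact ENNReal.toReal_mono ENNReal.one_ne_top (hQ.sqHellinger_le_one P x)
  have hq : (0 : ℝ) < Q.density x s := h.1
  have hexp : (1 - η) ^ 2 ≤ Real.exp (-(2 * η)) := by
    have h1 : 1 - η ≤ Real.exp (-η) := by linarith [Real.add_one_le_exp (-η)]
    calc (1 - η) ^ 2 ≤ Real.exp (-η) ^ 2 := pow_le_pow_left₀ (by linarith) h1 2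
      _ = Real.exp (-(2 * η)) := by rw [← Real.exp_nat_mul]; congr 1; push_cast; ring
  calc ENNReal.log (P.density x s : ℝ≥0∞)
      ≤ ENNReal.log (ENNReal.ofReal (Real.exp (-(2 * η)) * Q.density x s)) := by
        refine ENNReal.log_monotone ?_
        rw [← ENNReal.ofReal_coe_nnreal, h.2]
        exact ENNReal.ofReal_le_ofReal (mul_le_mul_of_nonneg_right hexp hq.le)
    _ = _ := by
        rw [ENNReal.log_ofReal_of_pos (by positivity), Real.log_mul (Real.exp_pos _).ne' hq.ne',
          Real.log_exp]
        congr 1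
        ring

lemma IsTypicalDataset.logLikelihood_le (hd : IsTypicalDataset Pcal Q d)
    (hQ : Q.IsDeterministic) (hP : P ∈ Pcal) :
    logLikelihood P d ≤
      ((∑ k, ∑ h, Real.log (Q.density ((d k).pair h) ((d k).state h.succ)) -
        2 * empiricalHellinger P Q d : ℝ) : EReal) := by
  rw [empiricalHellinger, Finset.mul_sum, ← Finset.sum_sub_distrib]
  simp only [Finset.mul_sum, ← Finset.sum_sub_distrib]
  simp only [logLikelihood, ereal_coe_sum]
  exact Finset.sum_le_sum fun k _ => Finset.sum_le_sum fun h _ =>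
    (hd P hP k h).log_density_le hQ

/-- The truth is in fact a maximizer of the likelihood, so any slack `β ≥ 0` suffices. -/
lemma IsTypicalDataset.mem_versionSpace (hd : IsTypicalDataset Pcal Q d)
    (hQ : Q.IsDeterministic) (hQP : Q ∈ Pcal) {β : ℝ} (hβ : 0 ≤ β) :
    Q ∈ versionSpace Pcal β d := by
  refine ⟨hQP, ?_⟩
  have hsup : (Pcal.sup fun P => logLikelihood P d) ≤ logLikelihood Q d := by
    refine Finset.sup_le fun P hP => (hd.logLikelihood_le hQ hP).trans ?_
    rw [hd.logLikelihood_eq hQP, EReal.coe_le_coe_iff]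
    linarith [empiricalHellinger_nonneg P Q d]
  refine (EReal.sub_le_sub hsup (EReal.coe_nonneg.2 hβ)).trans ?_
  rw [sub_zero]

lemma IsTypicalDataset.empiricalHellinger_le (hd : IsTypicalDataset Pcal Q d)
    (hQ : Q.IsDeterministic) (hQP : Q ∈ Pcal) {β : ℝ} (hP : P ∈ versionSpace Pcal β d) :
    2 * empiricalHellinger P Q d ≤ β := by
  have h1 : logLikelihood Q d - (β : EReal) ≤ logLikelihood P d :=
    (EReal.sub_le_sub (Finset.le_sup (f := fun Q => logLikelihood Q d) hQP) le_rfl).trans hP.2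
  have h2 := h1.trans (hd.logLikelihood_le hQ hP.1)
  rw [hd.logLikelihood_eq hQP, ← EReal.coe_sub, EReal.coe_le_coe_iff] at h2
  linarith

lemma finite_versionSpace (Pcal : Finset (TransitionModel ν)) (β : ℝ) (d : Dataset S A H K) :
    (versionSpace Pcal β d).Finite :=
  Pcal.finite_toSet.subset fun _ h => h.1

/-- Pessimism: if the true model is in the version space, then the suboptimality of the output is
at most the value that some model of the version space misses on the comparator. -/
lemma IsPessimisticOutput.exists_sub_le {β : ℝ} {r : S × A → ℝ} {πhat : Policy S A}
    (hout : IsPessimisticOutput Pcal β r s₀ d πhat) (hQ : Q ∈ versionSpace Pcal β d)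
    (πc : Policy S A) :
    ∃ P ∈ versionSpace Pcal β d,
      value H r Q πc 0 s₀ - value H r Q πhat 0 s₀ ≤
        value H r Q πc 0 s₀ - value H r P πc 0 s₀ := by
  have hfin := fun π : Policy S A =>
    (finite_versionSpace Pcal β d).image fun P => value H r P π 0 s₀
  obtain ⟨P, hP, hPeq⟩ := Set.Nonempty.csInf_mem (Set.Nonempty.image _ ⟨Q, hQ⟩) (hfin πc)
  refine ⟨P, hP, sub_le_sub_left ?_ _⟩
  calc value H r P πc 0 s₀ = pessimisticValue Pcal β r s₀ d πc := hPeq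
    _ ≤ pessimisticValue Pcal β r s₀ d πhat := hout πc
    _ ≤ value H r Q πhat 0 s₀ := csInf_le (hfin πhat).bddBelow ⟨Q, hQ, rfl⟩

/-- The suboptimality bound on a typical dataset. -/
lemma IsTypicalDataset.sub_value_le [IsSFiniteKernel ν] (hd : IsTypicalDataset Pcal Q d)
    (hQ : Q.IsDeterministic) (hQP : Q ∈ Pcal) (hK : 0 < K) {β : ℝ} (hβ : 0 ≤ β) {r : S × A → ℝ}
    (hr : Measurable r) {πhat : Policy S A} (hout : IsPessimisticOutput Pcal β r s₀ d πhat)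
    (πc : Policy S A)
    (hval : ∀ P ∈ Pcal, ∀ h s, h ≤ H → value H r P πc h s ∈ Set.Icc (0 : ℝ) 1)
    (hC : concentrability Pcal Q s₀ d πc ≠ ∞) :
    value H r Q πc 0 s₀ - value H r Q πhat 0 s₀ ≤
      (concentrability Pcal Q s₀ d πc).toReal * β / K := by
  obtain ⟨P, hP, hle⟩ := hout.exists_sub_le (hd.mem_versionSpace hQ hQP hβ) πc
  have hemp := hd.empiricalHellinger_le hQ hQP hP
  set C := concentrability Pcal Q s₀ d πc with hCdef
  have hpath : ∀ h : Fin H, (sqHellinger P Q (hQ.pathPair πc s₀ h)).toReal ≤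
      C.toReal / K * ∑ k, (sqHellinger P Q ((d k).pair h)).toReal := by
    intro h
    have hfin : ∀ k, sqHellinger P Q ((d k).pair h) ≠ ∞ := fun k => hQ.sqHellinger_ne_top P _
    have := ENNReal.toReal_mono
      (ENNReal.mul_ne_top hC (ENNReal.div_ne_top (ENNReal.sum_ne_top.2 fun k _ => hfin k)
        (by exact_mod_cast hK.ne')))
      (hQ.sqHellinger_pathPair_le hP.1 s₀ d πc hC hK h)
    rw [ENNReal.toReal_mul, ENNReal.toReal_div, ENNReal.toReal_sum fun k _ => hfin k,
      ENNReal.toReal_natCast, ← mul_div_assoc] at this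
    rwa [div_mul_eq_mul_div]
  have hsum : ∑ h : Fin H, (sqHellinger P Q (hQ.pathPair πc s₀ h)).toReal ≤
      C.toReal / K * empiricalHellinger P Q d := by
    rw [empiricalHellinger, Finset.sum_comm, Finset.mul_sum]
    exact Finset.sum_le_sum fun h _ => hpath h
  calc _ ≤ _ := hle
    _ ≤ 2 * ∑ h : Fin H, (sqHellinger P Q (hQ.pathPair πc s₀ h)).toReal :=
        hQ.value_sub_le hr P πc s₀ (hval P hP.1)
    -- The factor 2 of the value loss is absorbed by the factor 2 in the likelihood gap.
    _ ≤ C.toReal / K * (2 * empiricalHellinger P Q d) := by linarith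
    _ ≤ C.toReal / K * β := mul_le_mul_of_nonneg_left hemp (by positivity)
    _ = C.toReal * β / K := by ring

end Data

/-- If `p` holds almost surely and `μ B ≤ ε`, then `p` holds off `B` on a measurable set of
probability at least `1 - ε`. -/
lemma exists_measurableSet_forall_of_ae {Ω : Type*} [MeasurableSpace Ω] {μ : Measure Ω}
    [IsProbabilityMeasure μ] {p : Ω → Prop} (hp : ∀ᵐ ω ∂μ, p ω) {B : Set Ω} {ε : ℝ≥0∞}
    (hB : μ B ≤ ε) :
    ∃ E : Set Ω, MeasurableSet E ∧ 1 - ε ≤ μ E ∧ ∀ ω ∈ E, p ω ∧ ω ∉ B := by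
  -- `B` may be non-measurable, so the complement of a measurable hull of `N` is used.
  set N := {ω | ¬ p ω} ∪ B with hN
  refine ⟨(toMeasurable μ N)ᶜ, (measurableSet_toMeasurable μ N).compl, ?_, fun ω hω => ?_⟩
  · rw [prob_compl_eq_one_sub (measurableSet_toMeasurable μ N), measure_toMeasurable]
    refine tsub_le_tsub_left ?_ _
    calc μ N ≤ μ {ω | ¬ p ω} + μ B := measure_union_le _ _
      _ ≤ ε := by rw [ae_iff.1 hp, zero_add]; exact hB
  · have h : ω ∉ N := fun h => hω (subset_toMeasurable μ N h)
    exact ⟨by_contra fun hc => h (Or.inl hc), fun hc => h (Or.inr hc)⟩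

end OfflineRL

theorem mainTheorem4 :
    ∃ c : ℝ, 0 < c ∧
      ∀ (S A Ω : Type*) [MeasurableSpace S] [MeasurableSpace A] [MeasurableSpace Ω]
        (μ : Measure Ω) [IsProbabilityMeasure μ]
        (ν : Kernel (S × A) S) [IsSFiniteKernel ν]
        (H K : ℕ) (_ : 0 < H) (_ : 0 < K)
        (r : S × A → ℝ) (_ : Measurable r) (s₀ : S)
        (Pcal : Finset (OfflineRL.TransitionModel ν)) (Pstar : OfflineRL.TransitionModel ν)
        -- realizability
        (_ : Pstar ∈ Pcal)
        -- normalization of the values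
        (_ : ∀ P ∈ Pcal, ∀ (π : OfflineRL.Policy S A) (h : ℕ) (s : S), h ≤ H →
          OfflineRL.value H r P π h s ∈ Set.Icc (0 : ℝ) 1)
        (_ : Pstar.IsDeterministic)
        (D : Ω → OfflineRL.Dataset S A H K) (_ : OfflineRL.IsOfflineDataset μ Pstar s₀ D)
        (δ : ℝ) (_ : 0 < δ) (_ : δ < 1) (β : ℝ) (_ : β = 4 * Real.log (Pcal.card / δ)),
        -- with the data-dependent coefficient, simultaneously for all comparators
        (∃ E : Set Ω, MeasurableSet E ∧ 1 - ENNReal.ofReal δ ≤ μ E ∧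
          ∀ ω ∈ E, ∀ πhat : OfflineRL.Policy S A,
            OfflineRL.IsPessimisticOutput Pcal β r s₀ (D ω) πhat →
            ∀ πc : OfflineRL.Policy S A,
              ENNReal.ofReal
                  (OfflineRL.value H r Pstar πc 0 s₀ - OfflineRL.value H r Pstar πhat 0 s₀) ≤
                ENNReal.ofReal c * OfflineRL.concentrability Pcal Pstar s₀ (D ω) πc *
                  ENNReal.ofReal (Real.log (Pcal.card / δ)) / (K : ℝ≥0∞)) ∧
        -- with a constant that bounds the coefficient with probability at least `1 - δ`
        (∀ (πc : OfflineRL.Policy S A) (C : ℝ≥0),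
          μ {ω | (C : ℝ≥0∞) < OfflineRL.concentrability Pcal Pstar s₀ (D ω) πc} ≤
              ENNReal.ofReal δ →
          ∃ E : Set Ω, MeasurableSet E ∧ 1 - ENNReal.ofReal δ ≤ μ E ∧
            ∀ ω ∈ E, ∀ πhat : OfflineRL.Policy S A,
              OfflineRL.IsPessimisticOutput Pcal β r s₀ (D ω) πhat →
              OfflineRL.value H r Pstar πc 0 s₀ - OfflineRL.value H r Pstar πhat 0 s₀ ≤
                c * (C : ℝ) * Real.log (Pcal.card / δ) / K) := by
  -- The bound is `C β / K` with `β = 4 log(|𝒫|/δ)`.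
  refine ⟨4, by norm_num, ?_⟩
  intro S A Ω _ _ _ μ _ ν _ H K _ hK r hr s₀ Pcal Pstar hmem hval hdet D hD δ hδ0 hδ1 β hβ
  have hL : 0 < Real.log (Pcal.card / δ) := by
    refine Real.log_pos ((one_lt_div hδ0).2 (hδ1.trans_le ?_))
    exact_mod_cast Finset.card_pos.2 ⟨Pstar, hmem⟩
  have hbound : ∀ d : OfflineRL.Dataset S A H K, OfflineRL.IsTypicalDataset Pcal Pstar d →
      ∀ πhat : OfflineRL.Policy S A, OfflineRL.IsPessimisticOutput Pcal β r s₀ d πhat →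
      ∀ πc : OfflineRL.Policy S A, OfflineRL.concentrability Pcal Pstar s₀ d πc ≠ ∞ →
      OfflineRL.value H r Pstar πc 0 s₀ - OfflineRL.value H r Pstar πhat 0 s₀ ≤
        4 * (OfflineRL.concentrability Pcal Pstar s₀ d πc).toReal *
          Real.log (Pcal.card / δ) / K := by
    intro d hd πhat hout πc hC
    refine (hd.sub_value_le hdet hmem hK (by rw [hβ]; positivity) hr hout πc
      (fun P hP h s hh => hval P hP πc h s hh) hC).trans_eq ?_
    rw [hβ]
    ring
  have htyp := hD.ae_isTypicalDataset hdet Pcal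
  refine ⟨?_, fun πc C hC => ?_⟩
  · obtain ⟨E, hE, hμE, hgood⟩ := OfflineRL.exists_measurableSet_forall_of_ae htyp
      (B := ∅) (ε := ENNReal.ofReal δ) (by simp)
    refine ⟨E, hE, hμE, fun ω hω πhat hout πc => ?_⟩
    have hK' : (K : ℝ≥0∞) ≠ ∞ := ENNReal.natCast_ne_top K
    -- An infinite coefficient makes the right side infinite, because the logarithm is strictly
    -- positive.
    by_cases hC : OfflineRL.concentrability Pcal Pstar s₀ (D ω) πc = ∞
    · rw [hC, ENNReal.mul_top (by simp), ENNReal.top_mul (by simpa using hL),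
        ENNReal.top_div_of_ne_top hK']
      exact le_top
    · refine (ENNReal.ofReal_le_ofReal
        (hbound (D ω) (hgood ω hω).1 πhat hout πc hC)).trans_eq ?_
      rw [ENNReal.ofReal_div_of_pos (by exact_mod_cast hK), ENNReal.ofReal_natCast,
        ENNReal.ofReal_mul (by positivity), ENNReal.ofReal_mul (by norm_num),
        ENNReal.ofReal_toReal hC]
  -- Typicality costs no probability, so all of `δ` is available for the failure of the bound `C`.
  · obtain ⟨E, hE, hμE, hgood⟩ := OfflineRL.exists_measurableSet_forall_of_ae htyp hC
    refine ⟨E, hE, hμE, fun ω hω πhat hout => ?_⟩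
    have hle : OfflineRL.concentrability Pcal Pstar s₀ (D ω) πc ≤ C := not_lt.1 (hgood ω hω).2
    refine (hbound (D ω) (hgood ω hω).1 πhat hout πc
      (ne_top_of_le_ne_top ENNReal.coe_ne_top hle)).trans ?_
    have := ENNReal.toReal_mono ENNReal.coe_ne_top hle
    rw [ENNReal.coe_toReal] at this
    gcongr
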